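/- Let $\alpha,\lambda_0,\lambda_1,\lambda_3\in\mathbb R$ and $D=\sqrt{4\alpha^2\lambda_0^2+\lambda_1^2}$. Consider Kirchhoff's equations in Sokolov's case (with $\beta=0$) on $\mathbb R^6$: $$\begin{aligned} \dot s_1&=(\alpha r_1+s_3)s_2-\alpha^2r_2r_3, & \dot r_1&=(\alpha r_1+2s_3)r_2-r_3s_2,\\ \dot s_2&=(\alpha r_3-s_1)(\alpha r_1+s_3), & \dot r_2&=r_3s_1-r_1(\alpha r_1+2s_3),\\ \dot s_3&=-\alpha r_2s_3, & \dot r_3&=r_1s_2-r_2s_1, \end{aligned}\tag{1}$$ and let $\mathcal M\subset\mathbb R^6$ be the set (the invariant manifold of steady motions, IMSM) given by $$2\alpha^4\lambda_0^2r_1^2+\bigl(2\alpha^2\lambda_0^2+\lambda_1(\lambda_1-D)\bigr)s_2^2=\bigl(2\alpha^2\lambda_0^2+\lambda_1(\lambda_1-D)\bigr)\tfrac{\lambda_0}{\lambda_3},$$ $$s_1^2+s_2^2=\tfrac{\lambda_0}{\lambda_3},\qquad s_3=0,\qquad r_3=0,\qquad 2\alpha^2\lambda_0r_2+(\lambda_1-D)s_2=0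 .$$ The reduced equation is $$\dot s_2=-\frac{2\alpha\lambda_0(\lambda_0-\lambda_3s_2^2)}{(\lambda_1+D)\lambda_3}.\tag{2}$$ Put $s_2^0=-\sqrt{\lambda_0/\lambda_3}$, and let $p$ be the point $$r_1=0,\quad r_2=\frac{\lambda_1-D}{2\alpha^2\sqrt{\lambda_0\lambda_3}},\quad r_3=0,\quad s_1=0,\quad s_2=s_2^0,\quad s_3=0 .$$ "On $\mathcal M$" means: with respect to the motions of (1) that lie in $\mathcal M$. 1. Let $\alpha\neq0$, $\lambda_0>0$, $\lambda_3>0$. Along every motion of (1) that lies in $\mathcal M$ on an interval $[0,T)$, $s_2$ satisfies (2). For all real $s_1,s_2$ with $s_1^2+s_2^2=\lambda_0/\lambda_3$ there is a motion of (1) lying in $\mathcal M$ for all $t\ge0$ that starts at a point with these values of $s_1,s_2$. Moreover $s_2^0$ is an equilibrium of (2), and $p$ is the only point of $\mathcal M$ with $s_2=s_2^0$. 2. Suppose $\alpha>0$, $\lambda_0>0$, and either $\lambda_1<0,\ \lambda_3>0$ or $\lambda_1>0,\ \lambda_3>0$. Then, in the deviation $z=s_2-s_2^0$, the function $V=\frac12z^2$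 is positive definite and its derivative along (2) is negative definite near $z=0$; solutions of (2) starting near $s_2^0$ exist for all $t\ge0$; $s_2^0$ is an asymptotically stable equilibrium of (2); and $p$ is asymptotically stable on $\mathcal M$. 3. Suppose $\alpha<0$, $\lambda_0>0$, and either $\lambda_1<0,\ \lambda_3>0$ or $\lambda_1>0,\ \lambda_3>0$. Then $s_2^0$ is a Lyapunov unstable equilibrium of (2), and $p$ is unstable on $\mathcal M$. 4. Suppose $\alpha\neq0$, $\lambda_1>0$, and either $\lambda_0,\lambda_3>0$ or $\lambda_0,\lambda_3<0$. Then there is exactly one point $q\in\mathcal M$ with $s_2=s_2^0$. Both $p$ and $q$ (which coincide if $\lambda_0,\lambda_3>0$) are equilibria of (1), the linearization of (1) at each of them has an eigenvalue with positive real part, and each of them is unstable in the sense of Lyapunov in the whole space $\mathbb R^6$. -/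

import Mathlib

open Set Filter Topology

namespace SokolovTop

/-- The phase space, with coordinates in the order `(s₁, s₂, s₃, r₁, r₂, r₃)`. The notions of
stability used below do not depend on the choice of the norm on this space. -/
abbrev Phase : Type := Fin 6 → ℝ

/-- The right-hand side of Kirchhoff's equations in Sokolov's case with `β = 0`. -/
def field (α : ℝ) (x : Phase) : Phase :=
  let s₁ := x 0
  let s₂ := x 1
  let s₃ := x 2
  let r₁ := x 3
  let r₂ := x 4
  let r₃ := x 5
  ![(α * r₁ + s₃) * s₂ - α ^ 2 * r₂ * r₃,
    (α * r₃ - s₁) * (α * r₁ + s₃),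
    -α * r₂ * s₃,
    (α * r₁ + 2 * s₃) * r₂ - r₃ * s₂,
    r₃ * s₁ - r₁ * (α * r₁ + 2 * s₃),
    r₁ * s₂ - r₂ * s₁]

/-- The radical `√(4 α² λ₀² + λ₁²)`. -/
noncomputable def radical (α l₀ l₁ : ℝ) : ℝ := Real.sqrt (4 * α ^ 2 * l₀ ^ 2 + l₁ ^ 2)

/-- The element with parameters `λ₀, λ₁, λ₃` of the family of invariant manifolds of steady
motions, given by its five equations. -/
def imsm (α l₀ l₁ l₃ : ℝ) : Set Phase :=
  {x | let s₁ := x 0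
       let s₂ := x 1
       let s₃ := x 2
       let r₁ := x 3
       let r₂ := x 4
       let r₃ := x 5
       let D := radical α l₀ l₁
       2 * α ^ 4 * l₀ ^ 2 * r₁ ^ 2 + (2 * α ^ 2 * l₀ ^ 2 + l₁ * (l₁ - D)) * s₂ ^ 2
           = (2 * α ^ 2 * l₀ ^ 2 + l₁ * (l₁ - D)) * (l₀ / l₃) ∧
       s₁ ^ 2 + s₂ ^ 2 = l₀ / l₃ ∧
       s₃ = 0 ∧
       r₃ = 0 ∧
       2 * α ^ 2 * l₀ * r₂ + (l₁ - D) * s₂ = 0}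

/-- The right-hand side of the reduced one-dimensional equation for `s₂` on the manifold. -/
noncomputable def reducedField (α l₀ l₁ l₃ : ℝ) (s₂ : ℝ) : ℝ :=
  -(2 * α * l₀ * (l₀ - l₃ * s₂ ^ 2)) / ((l₁ + radical α l₀ l₁) * l₃)

/-- The equilibrium `s₂⁰ = -√(λ₀/λ₃)` of the reduced equation. -/
noncomputable def s₂eq (l₀ l₃ : ℝ) : ℝ := -Real.sqrt (l₀ / l₃)

/-- The corresponding stationary solution in the whole phase space. -/
noncomputable def fullPoint (α l₀ l₁ l₃ : ℝ) : Phase :=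
  ![0, -Real.sqrt (l₀ / l₃), 0,
    0, (l₁ - radical α l₀ l₁) / (2 * α ^ 2 * Real.sqrt (l₀ * l₃)), 0]

section Stability

variable {E : Type*} [NormedAddCommGroup E] [NormedSpace ℝ E]

/-- `x` is a motion of `ẋ = f(x)` on the time interval `I` which lies in the set `S`. -/
def IsMotionIn (f : E → E) (S : Set E) (I : Set ℝ) (x : ℝ → E) : Prop :=
  IsIntegralCurveOn x (fun _ => f) I ∧ ∀ t ∈ I, x t ∈ S

/-- Lyapunov stability of `p` with respect to the motions of `ẋ = f(x)` lying in `S`. Motions on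
bounded intervals are included, so finite-time escape is excluded as well. -/
def StableOn (f : E → E) (S : Set E) (p : E) : Prop :=
  ∀ ε > 0, ∃ δ > 0, ∀ T > 0, ∀ x : ℝ → E, IsMotionIn f S (Ico 0 T) x → ‖x 0 - p‖ < δ →
    ∀ t ∈ Ico 0 T, ‖x t - p‖ < ε

/-- Lyapunov instability of `p` with respect to the motions lying in `S`. -/
def UnstableOn (f : E → E) (S : Set E) (p : E) : Prop := ¬ StableOn f S p

/-- Asymptotic stability of `p` with respect to the motions of `ẋ = f(x)` lying in `S`. -/
def AsympStableOn (f : E → E) (S : Set E) (p : E) : Prop :=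
  StableOn f S p ∧
    ∃ δ > 0, ∀ x : ℝ → E, IsMotionIn f S (Ici 0) x → ‖x 0 - p‖ < δ → Tendsto x atTop (𝓝 p)

end Stability

/-- `V`, a function of the deviation `z = s - p`, is positive definite near `0`, and its derivative
along `ṡ = f(s)` is negative definite near `0`. -/
def IsStrictLyapunov (f : ℝ → ℝ) (p : ℝ) (V : ℝ → ℝ) : Prop :=
  Differentiable ℝ V ∧ V 0 = 0 ∧
    ∃ ρ > 0, ∀ z : ℝ, 0 < |z| → |z| < ρ → 0 < V z ∧ deriv V z * f (p + z) < 0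

/-- The linearization of `ẋ = f(x)` at `p` exists, and its characteristic polynomial has a complex
root with positive real part. -/
def HasUnstableEigenvalue (f : Phase → Phase) (p : Phase) : Prop :=
  ∃ A : Phase →L[ℝ] Phase, HasFDerivAt f A p ∧
    ∃ μ : ℂ, 0 < μ.re ∧
      ((LinearMap.toMatrix' (A : Phase →ₗ[ℝ] Phase)).map (algebraMap ℝ ℂ)).charpoly.IsRoot μ

/-- Parameter conditions for asymptotic stability on the manifold. -/
def CondAsymp (α l₀ l₁ l₃ : ℝ) : Prop :=
  0 < α ∧ 0 < l₀ ∧ ((l₁ < 0 ∧ 0 < l₃) ∨ (0 < l₁ ∧ 0 < l₃))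

/-- Parameter conditions for instability on the manifold. -/
def CondUnst (α l₀ l₁ l₃ : ℝ) : Prop :=
  α < 0 ∧ 0 < l₀ ∧ ((l₁ < 0 ∧ 0 < l₃) ∨ (0 < l₁ ∧ 0 < l₃))

/-- Parameter conditions for instability in the whole phase space. -/
def CondFull (α l₀ l₁ l₃ : ℝ) : Prop :=
  (α < 0 ∧ ((l₀ < 0 ∧ 0 < l₁ ∧ l₃ < 0) ∨ (0 < l₀ ∧ 0 < l₁ ∧ 0 < l₃))) ∨
  (0 < α ∧ ((l₀ < 0 ∧ 0 < l₁ ∧ l₃ < 0) ∨ (0 < l₀ ∧ 0 < l₁ ∧ 0 < l₃)))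

end SokolovTop

/-!
On the manifold of steady motions `r₃ = s₃ = 0`, the vector `(r₁, r₂)` equals `(± k s₁, k s₂)` with
`k = (D - λ₁) / (2 α² λ₀)`, and `(s₁, s₂)` runs on the circle of radius `R = √(λ₀ / λ₃)`
(`mem_imsm_iff`). The branch with the minus sign contains no motion except at `s₁ = 0`, where the
branches meet (`r₁_eq_of_isMotionIn_imsm`), so the motions in the manifold are governed by
`ṡ₂ = -c (R² - s₂²)` with `c = α k`, which is the reduced equation since
`(D - λ₁) (D + λ₁) = 4 α² λ₀²`.

This scalar equation has an elementary solution `kink`, and with its companion `bump` for `s₁` it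
gives global motions through every point of the circle (`exists_planarMotion`). For `c > 0`,
uniqueness of solutions transfers the exponential decay of `kink c R a t + R` to all solutions
starting near `-R`; on the manifold the other coordinates are controlled by `s₂ + R`
(`norm_sub_planarPoint_le`). For `c < 0`, the explicit solutions starting arbitrarily close to `-R`
reach `0` (`exists_kink_eq_zero`), which gives instability.

In the whole space both points in question have the form `s₂ = -R`, `r₂ = -k R` with the other
coordinates zero, for some `k ≠ 0`. The Jacobian there has the eigenvalues `± α k R`. If `α k < 0`,
the explicit planar motions show instability. If `α k > 0`, the unstable direction is `s₃`: from
`ṡ₃ = -α r₂ s₃` it follows that `s₃` grows exponentially as long as the motion stays near the point,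
so a motion which starts with `s₃ ≠ 0` has to leave
(`unstableOn_univ_of_linear_growth`, by means of a solution of a truncated equation).
-/

namespace SokolovTop

/-! ### General facts on autonomous equations -/

section Autonomous

variable {E : Type*} [NormedAddCommGroup E] [NormedSpace ℝ E] [FiniteDimensional ℝ E]

/-- Uniqueness for an autonomous `C¹` equation on `[0, T)`. -/
theorem integralCurveOn_Ico_unique {f : E → E} (hf : ContDiff ℝ 1 f) {T : ℝ} {x y : ℝ → E}
    (hx : IsIntegralCurveOn x (fun _ => f) (Ico 0 T))
    (hy : IsIntegralCurveOn y (fun _ => f) (Ico 0 T)) (h0 : x 0 = y 0) :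
    EqOn x y (Ico 0 T) := by
  intro t ht
  have hsub : Icc 0 t ⊆ Ico 0 T := fun u hu => ⟨hu.1, hu.2.trans_lt ht.2⟩
  have hxc : ContinuousOn x (Icc 0 t) := hx.continuousOn.mono hsub
  have hyc : ContinuousOn y (Icc 0 t) := hy.continuousOn.mono hsub
  have : ProperSpace E := FiniteDimensional.proper_real E
  obtain ⟨r, hr⟩ := ((isCompact_Icc.image_of_continuousOn hxc).isBounded.union
    (isCompact_Icc.image_of_continuousOn hyc).isBounded).subset_closedBall (0 : E)
  obtain ⟨K, hK⟩ := (hf.contDiffOn (s := Metric.closedBall (0 : E) r)).exists_lipschitzOnWith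
    one_ne_zero (convex_closedBall 0 r) (isCompact_closedBall 0 r)
  have hder : ∀ {z : ℝ → E}, IsIntegralCurveOn z (fun _ => f) (Ico 0 T) →
      ∀ u ∈ Ico 0 t, HasDerivWithinAt z (f (z u)) (Ici u) u := by
    intro z hz u hu
    have hu' : u ∈ Ico 0 T := hsub (Ico_subset_Icc_self hu)
    refine (hz u hu').mono_of_mem_nhdsWithin ?_
    filter_upwards [Ico_mem_nhdsGE hu'.2] with v hv using ⟨hu'.1.trans hv.1, hv.2⟩
  exact ODE_solution_unique_of_mem_Icc_right (v := fun _ => f) (K := K)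
    (s := fun _ => Metric.closedBall (0 : E) r) (fun _ _ => hK) hxc (hder hx)
    (fun u hu => hr (Or.inl ⟨u, Ico_subset_Icc_self hu, rfl⟩)) hyc (hder hy)
    (fun u hu => hr (Or.inr ⟨u, Ico_subset_Icc_self hu, rfl⟩)) h0 ⟨ht.1, le_rfl⟩

/-- A curve on the whole of `[0, T]` which solves `ẋ = f(x)` as long as it stays in a given ball:
it is an integral curve of `f` multiplied by a smooth cutoff function. -/
theorem exists_curve_integral_in_closedBall {f : E → E} (hf : ContDiff ℝ 1 f) {T ε : ℝ}
    (hT : 0 < T) (hε : 0 < ε) (p x₀ : E) :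
    ∃ y : ℝ → E, y 0 = x₀ ∧ ContinuousOn y (Icc 0 T) ∧
      ∀ t ∈ Icc 0 T, y t ∈ Metric.closedBall p ε →
        HasDerivWithinAt y (f (y t)) (Icc 0 T) t := by
  let φ : ContDiffBump p := ⟨ε, 2 * ε, hε, by linarith⟩
  let g : E → E := fun x => φ x • f x
  have hg : ContDiff ℝ 1 g := φ.contDiff.smul hf
  have hgs : HasCompactSupport g := φ.hasCompactSupport.smul_right
  obtain ⟨K, hK⟩ := hg.lipschitzWith_of_hasCompactSupport hgs one_ne_zero
  obtain ⟨C, hC⟩ := hgs.exists_bound_of_continuous hg.continuous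
  have hPL : IsPicardLindelof (fun _ => g) (⟨0, le_rfl, hT.le⟩ : Icc (0 : ℝ) T) x₀
      (C.toNNReal * T.toNNReal) 0 C.toNNReal K :=
    { lipschitzOnWith := fun _ _ => hK.lipschitzOnWith
      continuousOn := fun _ _ => continuousOn_const
      norm_le := fun _ _ x _ => (hC x).trans (Real.le_coe_toNNReal C)
      mul_max_le := by
        simp [hT.le] }
  obtain ⟨y, hy0, hy⟩ := hPL.exists_eq_forall_mem_Icc_hasDerivWithinAt₀
  refine ⟨y, hy0, fun t ht => (hy t ht).continuousWithinAt, fun t ht hb => ?_⟩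
  have h1 : φ (y t) = 1 := φ.one_of_mem_closedBall hb
  simpa [g, h1] using hy t ht

/-- An instability criterion: near `p`, the square of a linear form `ℓ` grows at an exponential
rate along the motions. -/
theorem unstableOn_univ_of_linear_growth {f : E → E} (hf : ContDiff ℝ 1 f) {p : E}
    (ℓ : E →L[ℝ] ℝ) (hℓ : ℓ ≠ 0) (hp : ℓ p = 0) {ε m : ℝ} (hε : 0 < ε) (hm : 0 < m)
    (h : ∀ x ∈ Metric.closedBall p ε, m * ℓ x ^ 2 ≤ ℓ x * ℓ (f x)) :
    UnstableOn f univ p := by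
  intro hst
  obtain ⟨δ, hδ, hst⟩ := hst (ε / 2) (by positivity)
  obtain ⟨v, hv⟩ : ∃ v, ℓ v ≠ 0 := by
    by_contra! hc
    exact hℓ (ContinuousLinearMap.ext hc)
  -- an initial point near `p` off the kernel of `ℓ`
  obtain ⟨x₀, hx₀, hx₀ε, hℓx₀⟩ : ∃ x₀, ‖x₀ - p‖ < δ ∧ ‖x₀ - p‖ < ε ∧ ℓ x₀ ≠ 0 := by
    have hc : Tendsto (fun η : ℝ => ‖η • v‖) (𝓝[>] 0) (𝓝 0) := by
      have : Continuous fun η : ℝ => ‖η • v‖ := by fun_prop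
      simpa using (this.tendsto 0).mono_left nhdsWithin_le_nhds
    obtain ⟨η, ⟨h1, h2⟩, h3⟩ := (((hc.eventually_lt_const hδ).and
      (hc.eventually_lt_const hε)).and self_mem_nhdsWithin).exists
    refine ⟨p + η • v, by simpa using h1, by simpa using h2, ?_⟩
    simpa [hp] using ⟨ne_of_gt h3, hv⟩
  set a := ℓ x₀ ^ 2 with ha
  have ha0 : 0 < a := by positivity
  set B := (‖ℓ‖ * ε) ^ 2 with hB
  obtain ⟨T, hT, hTB⟩ : ∃ T > 0, B < a * Real.exp (2 * m * T) := by
    have h1 : Tendsto (fun T => a * Real.exp (2 * m * T)) atTop atTop :=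
      (Real.tendsto_exp_atTop.comp (tendsto_id.const_mul_atTop (by positivity))).const_mul_atTop ha0
    obtain ⟨T, h2, h3⟩ := ((h1.eventually_gt_atTop B).and (eventually_gt_atTop 0)).exists
    exact ⟨T, h3, h2⟩
  obtain ⟨y, hy0, hyc, hy⟩ := exists_curve_integral_in_closedBall hf hT hε p x₀
  -- the curve leaves the open ball before the time `T`
  have hexit : ∃ t ∈ Icc 0 T, ε ≤ ‖y t - p‖ := by
    by_contra! hc
    have hyd : ∀ t ∈ Icc 0 T, HasDerivWithinAt y (f (y t)) (Icc 0 T) t := fun t ht =>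
      hy t ht (by simpa [dist_eq_norm] using (hc t ht).le)
    have hmono : MonotoneOn (fun t => ℓ (y t) ^ 2 * Real.exp (-(2 * m * t))) (Icc 0 T) := by
      have hd : ∀ t ∈ Icc 0 T, HasDerivWithinAt
          (fun t => ℓ (y t) ^ 2 * Real.exp (-(2 * m * t)))
          (2 * (ℓ (y t) * ℓ (f (y t)) - m * ℓ (y t) ^ 2) * Real.exp (-(2 * m * t)))
          (Icc 0 T) t := by
        intro t ht
        have h1 := (ℓ.hasFDerivAt.comp_hasDerivWithinAt t (hyd t ht)).pow 2
        have h2 : HasDerivWithinAt (fun t : ℝ => Real.exp (-(2 * m * t)))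
            (Real.exp (-(2 * m * t)) * (-(2 * m * 1))) (Icc 0 T) t :=
          (((hasDerivAt_id t).const_mul (2 * m)).neg.exp).hasDerivWithinAt
        refine (h1.mul h2).congr_deriv ?_
        simp only [Function.comp_apply, Pi.pow_apply]
        push_cast
        ring
      refine monotoneOn_of_hasDerivWithinAt_nonneg (convex_Icc 0 T)
        (fun t ht => (hd t ht).continuousWithinAt)
        (fun t ht => (hd t (interior_subset ht)).mono interior_subset) fun t ht => ?_
      have ht' : t ∈ Icc 0 T := interior_subset ht
      have := h (y t) (by simpa [dist_eq_norm] using (hc t ht').le)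
      have := sub_nonneg.2 this
      positivity
    have h0 : (0 : ℝ) ∈ Icc 0 T := ⟨le_rfl, hT.le⟩
    have hT' : T ∈ Icc 0 T := ⟨hT.le, le_rfl⟩
    have h1 := hmono h0 hT' hT.le
    simp only [hy0, mul_zero, neg_zero, Real.exp_zero, mul_one, Real.exp_neg] at h1
    rw [← div_eq_mul_inv, le_div_iff₀ (Real.exp_pos _)] at h1
    have h2 : |ℓ (y T)| ≤ ‖ℓ‖ * ε := by
      have h3 := ℓ.le_opNorm (y T - p)
      rw [map_sub, hp, sub_zero, Real.norm_eq_abs] at h3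
      exact h3.trans (mul_le_mul_of_nonneg_left (hc T hT').le (norm_nonneg _))
    have h3 : ℓ (y T) ^ 2 ≤ B := by
      rw [hB, ← sq_abs (ℓ (y T))]
      gcongr
    linarith
  -- `τ` is the first time at which the curve is not in the open ball
  set A := {t | t ∈ Icc 0 T ∧ ε ≤ ‖y t - p‖} with hA
  have hAc : IsClosed A := by
    have : ContinuousOn (fun t => ‖y t - p‖) (Icc 0 T) := (hyc.sub continuousOn_const).norm
    exact this.preimage_isClosed_of_isClosed isClosed_Icc isClosed_Ici
  have hAb : BddBelow A := ⟨0, fun t ht => ht.1.1⟩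
  have hτ : sInf A ∈ A := hAc.csInf_mem hexit hAb
  set τ := sInf A
  have hτ0 : 0 < τ := by
    rcases hτ.1.1.lt_or_eq with h1 | h1
    · exact h1
    · have := hτ.2
      rw [← h1, hy0] at this
      linarith
  have hsub : Ico 0 τ ⊆ Icc 0 T := fun t ht => ⟨ht.1, ht.2.le.trans hτ.1.2⟩
  have hmot : IsMotionIn f univ (Ico 0 τ) y := by
    refine ⟨fun t ht => (hy t (hsub ht) ?_).mono hsub, fun _ _ => mem_univ _⟩
    have : t ∉ A := fun hc => absurd (csInf_le hAb hc) (not_le.2 ht.2)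
    have := not_le.1 fun hc => this ⟨hsub ht, hc⟩
    simpa [dist_eq_norm] using this.le
  have hlt := hst τ hτ0 y hmot (by rwa [hy0])
  have hle : ‖y τ - p‖ ≤ ε / 2 := by
    have hcont : ContinuousWithinAt (fun t => ‖y t - p‖) (Ico 0 τ) τ :=
      (((hyc.sub continuousOn_const).norm) τ hτ.1).mono hsub
    have hcl : τ ∈ closure (Ico 0 τ) := by
      rw [closure_Ico hτ0.ne]
      exact ⟨hτ0.le, le_rfl⟩
    have : (𝓝[Ico 0 τ] τ).NeBot := mem_closure_iff_nhdsWithin_neBot.1 hcl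
    exact le_of_tendsto hcont (by
      filter_upwards [self_mem_nhdsWithin] with t ht using (hlt t ht).le)
  linarith [hτ.2]

end Autonomous

/-! ### The scalar equation `ṡ = -c (R² - s²)` -/

/-- The common denominator of the explicit solutions. -/
noncomputable def kinkDenom (c R a t : ℝ) : ℝ := R + a + (R - a) * Real.exp (c * R * t) ^ 2

/-- The solution of `ṡ = -c (R² - s²)` with the initial value `a`. For `|a| < R` it is the
hyperbolic tangent profile `-R tanh (c R t + const)`; the rational expression in `exp (c R t)`
also covers the remaining initial values. -/
noncomputable def kink (c R a t : ℝ) : ℝ :=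
  R * (R + a - (R - a) * Real.exp (c * R * t) ^ 2) / kinkDenom c R a t

/-- The companion of `kink` with initial value `b`: if `a² + b² = R²`, then
`(bump, kink)` moves on the circle of radius `R`. -/
noncomputable def bump (c R a b t : ℝ) : ℝ :=
  2 * R * b * Real.exp (c * R * t) / kinkDenom c R a t

theorem kink_zero {R : ℝ} (hR : 0 < R) (c a : ℝ) : kink c R a 0 = a := by
  simp [kink, kinkDenom]
  field_simp

theorem bump_zero {R : ℝ} (hR : 0 < R) (c a b : ℝ) : bump c R a b 0 = b := by
  simp [bump, kinkDenom]
  field_simp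
  ring

theorem kinkDenom_pos {c R a : ℝ} (hR : 0 < R) (ha : |a| ≤ R) (t : ℝ) :
    0 < kinkDenom c R a t := by
  obtain ⟨h1, h2⟩ := abs_le.1 ha
  have he := pow_pos (Real.exp_pos (c * R * t)) 2
  unfold kinkDenom
  rcases h2.lt_or_eq with h | h
  · have := mul_pos (sub_pos.2 h) he
    linarith
  · subst h
    simpa using hR

theorem one_le_exp_sq {c R t : ℝ} (hc : 0 < c) (hR : 0 < R) (ht : 0 ≤ t) :
    1 ≤ Real.exp (c * R * t) ^ 2 :=
  one_le_pow₀ (Real.one_le_exp (by positivity))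

/-- For `c > 0` initial values slightly below `-R` are admissible as well, in forward time. -/
theorem kinkDenom_pos_of_nonneg {c R a t : ℝ} (hc : 0 < c) (hR : 0 < R) (ha : a ≤ R)
    (ht : 0 ≤ t) : 0 < kinkDenom c R a t := by
  have h1 := one_le_exp_sq hc hR ht
  unfold kinkDenom
  nlinarith

theorem hasDerivAt_kinkDenom (c R a t : ℝ) :
    HasDerivAt (kinkDenom c R a) ((R - a) * (2 * c * R * Real.exp (c * R * t) ^ 2)) t := by
  have h : HasDerivAt (fun t => Real.exp (c * R * t)) (Real.exp (c * R * t) * (c * R * 1)) t :=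
    ((hasDerivAt_id t).const_mul (c * R)).exp
  refine (((h.pow 2).const_mul (R - a)).const_add (R + a)).congr_deriv ?_
  push_cast
  ring

theorem hasDerivAt_kink {c R a t : ℝ} (hd : kinkDenom c R a t ≠ 0) :
    HasDerivAt (kink c R a) (-c * (R ^ 2 - kink c R a t ^ 2)) t := by
  have h : HasDerivAt (fun t => Real.exp (c * R * t)) (Real.exp (c * R * t) * (c * R * 1)) t :=
    ((hasDerivAt_id t).const_mul (c * R)).exp
  have hn := ((((h.pow 2).const_mul (R - a)).const_sub (R + a)).const_mul R)
  refine (hn.div (hasDerivAt_kinkDenom c R a t) hd).congr_deriv ?_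
  have hk : kink c R a t
    = R * (R + a - (R - a) * Real.exp (c * R * t) ^ 2) / kinkDenom c R a t := rfl
  rw [hk]
  field_simp
  simp only [Pi.pow_apply, kinkDenom, mul_comm R c]
  push_cast
  ring

theorem hasDerivAt_bump {c R a b t : ℝ} (hd : kinkDenom c R a t ≠ 0) :
    HasDerivAt (bump c R a b) (c * bump c R a b t * kink c R a t) t := by
  have h : HasDerivAt (fun t => Real.exp (c * R * t)) (Real.exp (c * R * t) * (c * R * 1)) t :=
    ((hasDerivAt_id t).const_mul (c * R)).exp
  refine ((h.const_mul (2 * R * b)).div (hasDerivAt_kinkDenom c R a t) hd).congr_deriv ?_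
  simp only [bump, kink]
  field_simp
  simp only [kinkDenom, mul_comm R c]
  ring

theorem bump_sq_add_kink_sq {c R a b t : ℝ} (hd : kinkDenom c R a t ≠ 0)
    (hab : b ^ 2 + a ^ 2 = R ^ 2) : bump c R a b t ^ 2 + kink c R a t ^ 2 = R ^ 2 := by
  rw [bump, kink, div_pow, div_pow, ← add_div, div_eq_iff (pow_ne_zero 2 hd), kinkDenom]
  linear_combination 4 * R ^ 2 * Real.exp (c * R * t) ^ 2 * hab

/-- For `c > 0` the solutions starting near `-R` approach `-R` exponentially. -/
theorem abs_kink_add_le {c R a t : ℝ} (hc : 0 < c) (hR : 0 < R) (ha : |a + R| ≤ R)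
    (ht : 0 ≤ t) : |kink c R a t + R| ≤ 2 * |a + R| / Real.exp (c * R * t) ^ 2 := by
  obtain ⟨h1, h2⟩ := abs_le.1 ha
  have hd := kinkDenom_pos_of_nonneg (a := a) hc hR (by linarith) ht
  have he := one_le_exp_sq hc hR ht
  have hk : kink c R a t + R = 2 * R * (a + R) / kinkDenom c R a t := by
    rw [kink, div_add' _ _ _ hd.ne', kinkDenom]
    ring
  rw [hk, abs_div, abs_mul, abs_of_pos hd, abs_of_pos (by positivity : 0 < 2 * R),
    div_le_div_iff₀ hd (by positivity)]
  have hle : R * Real.exp (c * R * t) ^ 2 ≤ kinkDenom c R a t := by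
    unfold kinkDenom
    nlinarith
  nlinarith [abs_nonneg (a + R)]

/-- For `c < 0` every solution with initial value in `(-R, 0)` reaches `0`. -/
theorem exists_kink_eq_zero {c R a : ℝ} (hc : c < 0) (hR : 0 < R) (ha : a ∈ Ioo (-R) 0) :
    ∃ t, 0 ≤ t ∧ kink c R a t = 0 := by
  have h1 : 0 < R + a := by linarith [ha.1]
  have h2 : 0 < R - a := by linarith [ha.2]
  refine ⟨Real.log ((R + a) / (R - a)) / (2 * (c * R)), ?_, ?_⟩
  · refine div_nonneg_of_nonpos (Real.log_nonpos (by positivity) ?_) (by nlinarith)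
    rw [div_le_one h2]
    linarith [ha.2]
  · have hcR : c * R ≠ 0 := (mul_neg_of_neg_of_pos hc hR).ne
    have he : Real.exp (c * R * (Real.log ((R + a) / (R - a)) / (2 * (c * R)))) ^ 2
        = (R + a) / (R - a) := by
      rw [← Real.exp_nat_mul]
      have : ((2 : ℕ) : ℝ) * (c * R * (Real.log ((R + a) / (R - a)) / (2 * (c * R))))
          = Real.log ((R + a) / (R - a)) := by
        rw [← mul_assoc, Nat.cast_two, mul_div_cancel₀ _ (mul_ne_zero two_ne_zero hcR)]
      rw [this, Real.exp_log (by positivity)]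
    rw [kink, he, mul_div_cancel₀ _ h2.ne']
    simp

theorem contDiff_scalarField (c R : ℝ) : ContDiff ℝ 1 fun s : ℝ => -c * (R ^ 2 - s ^ 2) := by
  fun_prop

/-- By uniqueness every solution starting near `-R` obeys the estimate of the explicit one. -/
theorem abs_add_le_of_integralCurveOn {c R T : ℝ} (hc : 0 < c) (hR : 0 < R) {s : ℝ → ℝ}
    (hs : IsIntegralCurveOn s (fun _ s => -c * (R ^ 2 - s ^ 2)) (Ico 0 T))
    (h0 : |s 0 + R| ≤ R) {t : ℝ} (ht : t ∈ Ico 0 T) :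
    |s t + R| ≤ 2 * |s 0 + R| / Real.exp (c * R * t) ^ 2 := by
  have hk : IsIntegralCurveOn (kink c R (s 0)) (fun _ s => -c * (R ^ 2 - s ^ 2)) (Ico 0 T) :=
    fun u hu => (hasDerivAt_kink
      (kinkDenom_pos_of_nonneg hc hR (by linarith [(abs_le.1 h0).2]) hu.1).ne').hasDerivWithinAt
  rw [integralCurveOn_Ico_unique (contDiff_scalarField c R) hs hk (kink_zero hR c _).symm ht]
  exact abs_kink_add_le hc hR h0 ht.1

theorem tendsto_const_div_exp_sq {c R : ℝ} (hc : 0 < c) (hR : 0 < R) (K : ℝ) :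
    Tendsto (fun t => K / Real.exp (c * R * t) ^ 2) atTop (𝓝 0) := by
  have h : Tendsto (fun t => Real.exp (c * R * t)) atTop atTop :=
    Real.tendsto_exp_atTop.comp (tendsto_id.const_mul_atTop (by positivity))
  exact ((tendsto_pow_atTop two_ne_zero).comp h).const_div_atTop K

theorem asympStableOn_scalar {c R : ℝ} (hc : 0 < c) (hR : 0 < R) :
    AsympStableOn (fun s : ℝ => -c * (R ^ 2 - s ^ 2)) univ (-R) := by
  refine ⟨fun ε hε => ⟨min R (ε / 2), by positivity, fun T _ x hx h0 t ht => ?_⟩,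
    R, hR, fun x hx h0 => ?_⟩
  · simp only [Real.norm_eq_abs, sub_neg_eq_add] at h0 ⊢
    obtain ⟨h1, h2⟩ := lt_min_iff.1 h0
    have := abs_add_le_of_integralCurveOn hc hR hx.1 h1.le ht
    have h3 : 2 * |x 0 + R| / Real.exp (c * R * t) ^ 2 ≤ 2 * |x 0 + R| :=
      div_le_self (by positivity) (one_le_exp_sq hc hR ht.1)
    linarith
  · simp only [Real.norm_eq_abs, sub_neg_eq_add] at h0
    rw [tendsto_iff_norm_sub_tendsto_zero]
    refine squeeze_zero' (Eventually.of_forall fun _ => norm_nonneg _) ?_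
      (tendsto_const_div_exp_sq hc hR (2 * |x 0 + R|))
    filter_upwards [eventually_ge_atTop 0] with t ht
    rw [Real.norm_eq_abs, sub_neg_eq_add]
    exact abs_add_le_of_integralCurveOn (T := t + 1) hc hR (hx.1.mono Ico_subset_Ici_self) h0.le
      ⟨ht, by linarith⟩

theorem unstableOn_scalar {c R : ℝ} (hc : c < 0) (hR : 0 < R) :
    UnstableOn (fun s : ℝ => -c * (R ^ 2 - s ^ 2)) univ (-R) := by
  intro hst
  obtain ⟨δ, hδ, hst⟩ := hst R hR
  set η := min (δ / 2) (R / 2) with hη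
  have hη0 : 0 < η := by positivity
  have hηδ : η < δ := (min_le_left _ _).trans_lt (by linarith)
  have hηR : η < R := (min_le_right _ _).trans_lt (by linarith)
  obtain ⟨t, ht, hkt⟩ := exists_kink_eq_zero (a := -R + η) hc hR ⟨by linarith, by linarith⟩
  have habs : |-R + η| ≤ R := abs_le.2 ⟨by linarith, by linarith⟩
  have h := hst (t + 1) (by linarith) (kink c R (-R + η))
    ⟨fun u _ => (hasDerivAt_kink (kinkDenom_pos hR habs u).ne').hasDerivWithinAt,
      fun _ _ => mem_univ _⟩
    (by rw [kink_zero hR]; simpa [abs_of_pos hη0] using hηδ) t ⟨ht, by linarith⟩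
  rw [hkt] at h
  simp [abs_of_pos hR] at h

/-- `z²/2` is a strict Lyapunov function because `f(-R + z) = -c z (2R - z)`. -/
theorem isStrictLyapunov_scalar {c R : ℝ} (hc : 0 < c) (hR : 0 < R) :
    IsStrictLyapunov (fun s : ℝ => -c * (R ^ 2 - s ^ 2)) (-R) (fun z => z ^ 2 / 2) := by
  refine ⟨by fun_prop, by simp, R, hR, fun z hz hzR => ?_⟩
  have hz2 : 0 < z ^ 2 := by
    rw [← sq_abs]
    positivity
  refine ⟨by positivity, ?_⟩
  have hd : deriv (fun z : ℝ => z ^ 2 / 2) z = z := by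
    have : HasDerivAt (fun z : ℝ => z ^ 2 / 2) z z :=
      ((hasDerivAt_pow 2 z).div_const 2).congr_deriv (by push_cast; ring)
    exact this.deriv
  rw [hd]
  have h2 : 0 < 2 * R - z := by linarith [(abs_lt.1 hzR).2]
  have := mul_pos (mul_pos hc hz2) h2
  linear_combination this

/-! ### Planar motions -/

/-- The state with momenta `(s₁, s₂, 0)` and `(k s₁, k s₂, 0)`. The states of this form with a
given `k` make up a plane which is invariant under the equations of motion. -/
def planarPoint (k s₁ s₂ : ℝ) : Phase := ![s₁, s₂, 0, k * s₁, k * s₂, 0]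

theorem field_planarPoint (α k s₁ s₂ : ℝ) :
    field α (planarPoint k s₁ s₂) = planarPoint k (α * k * s₁ * s₂) (-(α * k) * s₁ ^ 2) := by
  ext i
  fin_cases i <;> simp [field, planarPoint, -mul_eq_mul_right_iff] <;> ring

theorem field_planarPoint_zero (α k s₂ : ℝ) : field α (planarPoint k 0 s₂) = 0 := by
  rw [field_planarPoint]
  ext i
  fin_cases i <;> simp [planarPoint]

theorem hasDerivAt_planarPoint {k t u' v' : ℝ} {u v : ℝ → ℝ} (hu : HasDerivAt u u' t)
    (hv : HasDerivAt v v' t) :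
    HasDerivAt (fun t => planarPoint k (u t) (v t)) (planarPoint k u' v') t := by
  rw [hasDerivAt_pi]
  intro i
  fin_cases i
  · exact hu
  · exact hv
  · exact hasDerivAt_const t 0
  · exact hu.const_mul k
  · exact hv.const_mul k
  · exact hasDerivAt_const t 0

theorem hasDerivAt_planarMotion {α k R a b : ℝ} (hR : 0 < R) (ha : |a| ≤ R)
    (hab : b ^ 2 + a ^ 2 = R ^ 2) (t : ℝ) :
    HasDerivAt (fun t => planarPoint k (bump (α * k) R a b t) (kink (α * k) R a t))
      (field α (planarPoint k (bump (α * k) R a b t) (kink (α * k) R a t))) t := by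
  have hd := (kinkDenom_pos (c := α * k) hR ha t).ne'
  rw [field_planarPoint]
  refine (hasDerivAt_planarPoint (hasDerivAt_bump hd) (hasDerivAt_kink hd)).congr_deriv ?_
  congr 1
  linear_combination (-(α * k)) * -(bump_sq_add_kink_sq (c := α * k) (t := t) hd hab)

/-- Through every point of the circle `s₁² + s₂² = R²` in the plane there is a global motion which
stays on that circle. -/
theorem exists_planarMotion {α k R a b : ℝ} (hR : 0 < R) (hab : b ^ 2 + a ^ 2 = R ^ 2)
    {S : Set Phase} (hS : ∀ s₁ s₂, s₁ ^ 2 + s₂ ^ 2 = R ^ 2 → planarPoint k s₁ s₂ ∈ S)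
    (I : Set ℝ) :
    IsMotionIn (field α) S I
      (fun t => planarPoint k (bump (α * k) R a b t) (kink (α * k) R a t)) := by
  have ha : |a| ≤ R := abs_le_of_sq_le_sq (by nlinarith [sq_nonneg b]) hR.le
  exact ⟨fun t _ => (hasDerivAt_planarMotion hR ha hab t).hasDerivWithinAt,
    fun t _ => hS _ _ (bump_sq_add_kink_sq (kinkDenom_pos hR ha t).ne' hab)⟩

/-- If `α k < 0`, planar motions on the circle leave every small neighbourhood of `s₂ = -R`. -/
theorem unstableOn_planarPoint {α k R : ℝ} (hR : 0 < R) (hc : α * k < 0)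
    {S : Set Phase} (hS : ∀ s₁ s₂, s₁ ^ 2 + s₂ ^ 2 = R ^ 2 → planarPoint k s₁ s₂ ∈ S) :
    UnstableOn (field α) S (planarPoint k 0 (-R)) := by
  intro hst
  obtain ⟨δ, hδ, hst⟩ := hst R hR
  obtain ⟨a, ha, haδ⟩ : ∃ a ∈ Ioo (-R) 0,
      ‖planarPoint k √(R ^ 2 - a ^ 2) a - planarPoint k 0 (-R)‖ < δ := by
    have hcont : Continuous fun a : ℝ =>
        ‖planarPoint k √(R ^ 2 - a ^ 2) a - planarPoint k 0 (-R)‖ := by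
      have : Continuous fun a : ℝ => planarPoint k √(R ^ 2 - a ^ 2) a := by
        refine continuous_pi fun i => ?_
        fin_cases i <;> simp [planarPoint] <;> fun_prop
      fun_prop
    have hlim := (hcont.tendsto (-R)).mono_left (nhdsWithin_le_nhds (s := Ioi (-R)))
    simp only [even_two, Even.neg_pow, sub_self, Real.sqrt_zero, norm_zero] at hlim
    obtain ⟨a, h1, h2⟩ := ((hlim.eventually_lt_const hδ).and
      (Ioo_mem_nhdsGT (by linarith : -R < 0))).exists
    exact ⟨a, h2, h1⟩
  have hab : √(R ^ 2 - a ^ 2) ^ 2 + a ^ 2 = R ^ 2 := by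
    rw [Real.sq_sqrt (by nlinarith [ha.1, ha.2])]
    ring
  obtain ⟨t, ht, hkt⟩ := exists_kink_eq_zero hc hR ha
  have h := hst (t + 1) (by linarith) _ (exists_planarMotion (α := α) hR hab hS _)
    (by simpa only [kink_zero hR, bump_zero hR] using haδ) t ⟨ht, by linarith⟩
  have h1 := (norm_le_pi_norm _ (1 : Fin 6)).trans_lt h
  simp [planarPoint, hkt, abs_of_pos hR] at h1

/-! ### Linearization and instability in the whole space -/

theorem contDiff_field (α : ℝ) : ContDiff ℝ 1 (field α) := by
  rw [contDiff_pi]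
  intro i
  fin_cases i <;> simp [field] <;> fun_prop

/-- The Jacobian matrix of the equations of motion at `planarPoint k 0 σ`. -/
def jacobian (α k σ : ℝ) : Matrix (Fin 6) (Fin 6) ℝ :=
  !![0, 0, σ, α * σ, 0, -(α ^ 2 * k * σ);
     0, 0, 0, 0, 0, 0;
     0, 0, -(α * k * σ), 0, 0, 0;
     0, 0, 2 * k * σ, α * k * σ, 0, -σ;
     0, 0, 0, 0, 0, 0;
     -(k * σ), 0, 0, σ, 0, 0]

theorem field_planarPoint_add_smul (α k σ t : ℝ) (v : Phase) :
    field α (planarPoint k 0 σ + t • v)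
      = t • (jacobian α k σ).mulVec v + t ^ 2 • field α v := by
  ext i
  fin_cases i <;>
    simp [field, planarPoint, jacobian, dotProduct, Fin.sum_univ_succ] <;> ring

theorem toMatrix'_fderiv_field (α k σ : ℝ) :
    LinearMap.toMatrix' (fderiv ℝ (field α) (planarPoint k 0 σ) : Phase →ₗ[ℝ] Phase)
      = jacobian α k σ := by
  rw [← LinearMap.toMatrix'_toLin' (jacobian α k σ)]
  congr 1
  refine LinearMap.ext fun v => ?_
  have hf : HasFDerivAt (field α) (fderiv ℝ (field α) (planarPoint k 0 σ))
      (planarPoint k 0 σ + (0 : ℝ) • v) := by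
    rw [zero_smul, add_zero]
    exact ((contDiff_field α).differentiable one_ne_zero _).hasFDerivAt
  have h1 := hf.comp_hasDerivAt (0 : ℝ)
    (((hasDerivAt_id (0 : ℝ)).smul_const v).const_add (planarPoint k 0 σ))
  have h2 : HasDerivAt (fun t : ℝ => t • (jacobian α k σ).mulVec v + t ^ 2 • field α v)
      ((jacobian α k σ).mulVec v) 0 := by
    refine (((hasDerivAt_id (0 : ℝ)).smul_const _).add
      ((hasDerivAt_pow 2 (0 : ℝ)).smul_const _)).congr_deriv ?_
    simp
  have h3 : (field α ∘ fun t : ℝ => planarPoint k 0 σ + id t • v)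
      = fun t : ℝ => t • (jacobian α k σ).mulVec v + t ^ 2 • field α v :=
    funext fun t => field_planarPoint_add_smul α k σ t v
  rw [h3] at h1
  simpa using h1.unique h2

/-- The linearization has the eigenvalues `∓ α k σ`: the first one with the left eigenvector
`e₃`, the second one with the right eigenvector `(1, 0, 0, k, 0, 0)`. -/
theorem hasUnstableEigenvalue_planarPoint {α k σ : ℝ} (h : α * k * σ ≠ 0) :
    HasUnstableEigenvalue (field α) (planarPoint k 0 σ) := by
  refine ⟨_, ((contDiff_field α).differentiable one_ne_zero _).hasFDerivAt, ?_⟩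
  rw [toMatrix'_fderiv_field]
  suffices ∃ μ : ℝ, 0 < μ ∧ (jacobian α k σ).charpoly.IsRoot μ by
    obtain ⟨μ, hμ, hr⟩ := this
    refine ⟨μ, by simpa using hμ, ?_⟩
    rw [Matrix.charpoly_map]
    exact hr.map (f := algebraMap ℝ ℂ)
  rcases lt_or_gt_of_ne h with h | h
  · refine ⟨-(α * k * σ), by linarith, ?_⟩
    rw [Polynomial.IsRoot, Matrix.eval_charpoly, ← Matrix.exists_vecMul_eq_zero_iff]
    refine ⟨![0, 0, 1, 0, 0, 0], fun hc => by simpa using congrFun hc 2, ?_⟩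
    ext i
    fin_cases i <;> simp [Matrix.vecMul, dotProduct, Fin.sum_univ_succ, jacobian]
  · refine ⟨α * k * σ, h, ?_⟩
    rw [Polynomial.IsRoot, Matrix.eval_charpoly, ← Matrix.exists_mulVec_eq_zero_iff]
    refine ⟨![1, 0, 0, k, 0, 0], fun hc => by simpa using congrFun hc 0, ?_⟩
    ext i
    fin_cases i <;> simp [Matrix.mulVec, dotProduct, Fin.sum_univ_succ, jacobian] <;> ring

/-- The unstable direction lies in the plane if `α k < 0`, and is that of `s₃` if `α k > 0`: then
`ṡ₃ = -α r₂ s₃` with `-α r₂` close to `α k R`. -/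
theorem unstableOn_univ_planarPoint {α k R : ℝ} (hR : 0 < R) (h : α * k ≠ 0) :
    UnstableOn (field α) univ (planarPoint k 0 (-R)) := by
  rcases lt_or_gt_of_ne h with h | h
  · exact unstableOn_planarPoint hR h fun _ _ _ => mem_univ _
  · have hm : 0 < α * k * R / 2 := by positivity
    have hopen : {x : Phase | α * k * R / 2 < -α * x 4} ∈ 𝓝 (planarPoint k 0 (-R)) := by
      refine (isOpen_lt (by fun_prop) (by fun_prop)).mem_nhds ?_
      simp only [mem_ofPred_eq, planarPoint, Matrix.cons_val]
      linarith
    obtain ⟨ε, hε, hball⟩ := Metric.nhds_basis_closedBall.mem_iff.1 hopen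
    refine unstableOn_univ_of_linear_growth (contDiff_field α)
      (ContinuousLinearMap.proj (R := ℝ) (φ := fun _ : Fin 6 => ℝ) 2) ?_ ?_ hε hm fun x hx => ?_
    · intro hc
      simpa using congrArg (fun ℓ : Phase →L[ℝ] ℝ => ℓ (fun _ => 1)) hc
    · simp [planarPoint]
    · have h1 : α * k * R / 2 < -α * x 4 := hball hx
      have h2 := mul_le_mul_of_nonneg_right h1.le (sq_nonneg (x 2))
      simp only [ContinuousLinearMap.proj_apply, field, Matrix.cons_val]
      linarith

/-! ### The invariant manifold of steady motions -/

/-- The ratio `(r₁, r₂) : (s₁, s₂)` along the motions in the manifold. -/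
noncomputable def slope (α l₀ l₁ : ℝ) : ℝ := (radical α l₀ l₁ - l₁) / (2 * α ^ 2 * l₀)

theorem radical_sq (α l₀ l₁ : ℝ) : radical α l₀ l₁ ^ 2 = 4 * α ^ 2 * l₀ ^ 2 + l₁ ^ 2 :=
  Real.sq_sqrt (by positivity)

theorem abs_lt_radical {α l₀ : ℝ} (hα : α ≠ 0) (h₀ : l₀ ≠ 0) (l₁ : ℝ) :
    |l₁| < radical α l₀ l₁ := by
  rw [radical, ← Real.sqrt_sq_eq_abs]
  refine Real.sqrt_lt_sqrt (sq_nonneg _) ?_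
  have : 0 < 4 * α ^ 2 * l₀ ^ 2 := by positivity
  linarith

theorem slope_ne_zero {α l₀ : ℝ} (hα : α ≠ 0) (h₀ : l₀ ≠ 0) (l₁ : ℝ) : slope α l₀ l₁ ≠ 0 := by
  have := (le_abs_self l₁).trans_lt (abs_lt_radical hα h₀ l₁)
  exact div_ne_zero (by linarith) (by positivity)

theorem slope_pos {α l₀ : ℝ} (hα : α ≠ 0) (h₀ : 0 < l₀) (l₁ : ℝ) : 0 < slope α l₀ l₁ := by
  have := (le_abs_self l₁).trans_lt (abs_lt_radical hα h₀.ne' l₁)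
  exact div_pos (by linarith) (by positivity)

theorem reducedField_eq {α l₀ l₃ : ℝ} (hα : α ≠ 0) (h₀ : 0 < l₀) (h₃ : 0 < l₃) (l₁ : ℝ) :
    reducedField α l₀ l₁ l₃
      = fun s => -(α * slope α l₀ l₁) * (√(l₀ / l₃) ^ 2 - s ^ 2) := by
  ext s
  have hD := radical_sq α l₀ l₁
  have hD' : l₁ + radical α l₀ l₁ ≠ 0 := by
    have := (neg_le_abs l₁).trans_lt (abs_lt_radical hα h₀.ne' l₁)
    linarith
  have hk : slope α l₀ l₁ = 2 * l₀ / (l₁ + radical α l₀ l₁) := by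
    rw [slope, div_eq_div_iff (by positivity) hD']
    linear_combination hD
  rw [reducedField, Real.sq_sqrt (by positivity), hk]
  field_simp

/-- The quadratic equations of the manifold say that `(r₁, r₂) = (± k s₁, k s₂)` and that
`(s₁, s₂)` lies on a circle, because
`2 α² λ₀² + λ₁ (λ₁ - D) = (D - λ₁)² / 2 = 2 α⁴ λ₀² k²`. -/
theorem mem_imsm_iff {α l₀ : ℝ} (hα : α ≠ 0) (h₀ : l₀ ≠ 0) (l₁ : ℝ) {l₃ : ℝ} (h : 0 < l₀ / l₃)
    (x : Phase) :
    x ∈ imsm α l₀ l₁ l₃ ↔ x 3 ^ 2 = (slope α l₀ l₁ * x 0) ^ 2 ∧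
      x 0 ^ 2 + x 1 ^ 2 = √(l₀ / l₃) ^ 2 ∧ x 2 = 0 ∧ x 5 = 0 ∧ x 4 = slope α l₀ l₁ * x 1 := by
  have hD : radical α l₀ l₁ - l₁ = 2 * α ^ 2 * l₀ * slope α l₀ l₁ := by
    rw [slope]
    field_simp
  have hK : 2 * α ^ 2 * l₀ ^ 2 + l₁ * (l₁ - radical α l₀ l₁)
      = 2 * α ^ 4 * l₀ ^ 2 * slope α l₀ l₁ ^ 2 := by
    linear_combination (radical α l₀ l₁ - l₁ + 2 * α ^ 2 * l₀ * slope α l₀ l₁) / 2 * hD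
      - radical_sq α l₀ l₁ / 2
  have h1 : 2 * α ^ 4 * l₀ ^ 2 ≠ 0 := by positivity
  have h2 : 2 * α ^ 2 * l₀ ≠ 0 := by positivity
  rw [Real.sq_sqrt h.le]
  simp only [imsm, mem_ofPred_eq, hK]
  constructor
  · rintro ⟨e1, e2, e3, e4, e5⟩
    refine ⟨mul_left_cancel₀ h1 ?_, e2, e3, e4, mul_left_cancel₀ h2 ?_⟩
    · linear_combination e1 - 2 * α ^ 4 * l₀ ^ 2 * slope α l₀ l₁ ^ 2 * e2
    · linear_combination e5 + x 1 * hD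
  · rintro ⟨e1, e2, e3, e4, e5⟩
    refine ⟨?_, e2, e3, e4, ?_⟩
    · linear_combination 2 * α ^ 4 * l₀ ^ 2 * e1
        + 2 * α ^ 4 * l₀ ^ 2 * slope α l₀ l₁ ^ 2 * e2
    · linear_combination 2 * α ^ 2 * l₀ * e5 - x 1 * hD

theorem planarPoint_mem_imsm {α l₀ : ℝ} (hα : α ≠ 0) (h₀ : l₀ ≠ 0) (l₁ : ℝ) {l₃ : ℝ}
    (h : 0 < l₀ / l₃) (s₁ s₂ : ℝ) (hs : s₁ ^ 2 + s₂ ^ 2 = √(l₀ / l₃) ^ 2) :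
    planarPoint (slope α l₀ l₁) s₁ s₂ ∈ imsm α l₀ l₁ l₃ := by
  rw [mem_imsm_iff hα h₀ l₁ h]
  exact ⟨rfl, hs, rfl, rfl, rfl⟩

theorem mem_imsm_and_eq_s₂eq_iff {α l₀ : ℝ} (hα : α ≠ 0) (h₀ : l₀ ≠ 0) (l₁ : ℝ) {l₃ : ℝ}
    (h : 0 < l₀ / l₃) (x : Phase) :
    x ∈ imsm α l₀ l₁ l₃ ∧ x 1 = s₂eq l₀ l₃
      ↔ x = planarPoint (slope α l₀ l₁) 0 (-√(l₀ / l₃)) := by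
  constructor
  · rintro ⟨hx, h1⟩
    rw [s₂eq] at h1
    obtain ⟨e1, e2, e3, e4, e5⟩ := (mem_imsm_iff hα h₀ l₁ h x).1 hx
    rw [h1, neg_sq, add_eq_right, sq_eq_zero_iff] at e2
    rw [e2, mul_zero, zero_pow two_ne_zero, sq_eq_zero_iff] at e1
    rw [h1] at e5
    ext i
    fin_cases i <;> simp [planarPoint, *]
  · rintro rfl
    exact ⟨planarPoint_mem_imsm hα h₀ l₁ h _ _ (by ring), rfl⟩

/-- The square root `√(λ₀ λ₃)` always gives `|λ₀|` in the denominator, so for negative `λ₀, λ₃`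
this point is not in the manifold. -/
theorem fullPoint_eq {α l₀ l₃ : ℝ} (hα : α ≠ 0) (l₁ : ℝ) (h : 0 < l₀ / l₃) :
    fullPoint α l₀ l₁ l₃
      = planarPoint ((radical α l₀ l₁ - l₁) / (2 * α ^ 2 * |l₀|)) 0 (-√(l₀ / l₃)) := by
  have h0 : l₀ ≠ 0 := by rintro rfl; simp at h
  have h3 : l₃ ≠ 0 := by rintro rfl; simp at h
  have hmul : 0 < l₀ * l₃ := by
    have : l₀ * l₃ = l₀ / l₃ * l₃ ^ 2 := by field_simp
    rw [this]
    positivity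
  have habs : |l₀| = √(l₀ * l₃) * √(l₀ / l₃) := by
    rw [← Real.sqrt_mul hmul.le, ← Real.sqrt_sq_eq_abs]
    congr 1
    field_simp
  have hs1 : √(l₀ * l₃) ≠ 0 := (Real.sqrt_pos.2 hmul).ne'
  have hs2 : √(l₀ / l₃) ≠ 0 := (Real.sqrt_pos.2 h).ne'
  have : (l₁ - radical α l₀ l₁) / (2 * α ^ 2 * √(l₀ * l₃))
      = (radical α l₀ l₁ - l₁) / (2 * α ^ 2 * |l₀|) * (-√(l₀ / l₃)) := by
    rw [habs]
    field_simp
    ring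
  rw [fullPoint, this]
  ext i
  fin_cases i <;> simp [planarPoint]

theorem fullPoint_eq_of_pos {α l₀ l₃ : ℝ} (hα : α ≠ 0) (h₀ : 0 < l₀) (l₁ : ℝ)
    (h₃ : 0 < l₃) :
    fullPoint α l₀ l₁ l₃ = planarPoint (slope α l₀ l₁) 0 (-√(l₀ / l₃)) := by
  rw [fullPoint_eq hα l₁ (by positivity), abs_of_pos h₀, slope]

/-- On the manifold the distance from the steady motion is controlled by the deviation of `s₂`. -/
theorem norm_sub_planarPoint_le {α l₀ : ℝ} (hα : α ≠ 0) (h₀ : l₀ ≠ 0) (l₁ : ℝ) {l₃ : ℝ}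
    (h : 0 < l₀ / l₃) {x : Phase} (hx : x ∈ imsm α l₀ l₁ l₃) :
    ‖x - planarPoint (slope α l₀ l₁) 0 (-√(l₀ / l₃))‖
      ≤ (1 + |slope α l₀ l₁|) *
        (|x 1 + √(l₀ / l₃)| + √(2 * √(l₀ / l₃) * |x 1 + √(l₀ / l₃)|)) := by
  obtain ⟨e1, e2, e3, e4, e5⟩ := (mem_imsm_iff hα h₀ l₁ h x).1 hx
  set k := slope α l₀ l₁
  set R := √(l₀ / l₃)
  have hR : 0 < R := Real.sqrt_pos.2 h
  set A := |x 1 + R|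
  set B := √(2 * R * A)
  have hA : 0 ≤ A := abs_nonneg _
  have hB : 0 ≤ B := Real.sqrt_nonneg _
  have hk : 0 ≤ |k| := abs_nonneg _
  -- `s₁² = (R + s₂) (R - s₂) ≤ 2 R |s₂ + R|`
  have h0 : |x 0| ≤ B := by
    refine Real.abs_le_sqrt ?_
    have h1 := abs_le_of_sq_le_sq' (by nlinarith [sq_nonneg (x 0)] : x 1 ^ 2 ≤ R ^ 2) hR.le
    have : A = x 1 + R := abs_of_nonneg (by linarith [h1.1])
    rw [this]
    nlinarith [h1.1, h1.2]
  have h3 : |x 3| ≤ |k| * B := by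
    rw [sq_eq_sq_iff_abs_eq_abs, abs_mul] at e1
    rw [e1]
    gcongr
  have h4 : |x 4 + k * R| ≤ |k| * A := by
    rw [e5, ← mul_add, abs_mul]
  have hkA : 0 ≤ |k| * A := by positivity
  have hkB : 0 ≤ |k| * B := by positivity
  have hsum : (1 + |k|) * (A + B) = A + B + |k| * A + |k| * B := by ring
  rw [hsum]
  refine (pi_norm_le_iff_of_nonneg (by positivity)).2 fun i => ?_
  fin_cases i
  · simp [planarPoint]; linarith
  · simp [planarPoint]; linarith
  · simp [planarPoint, e3]; linarith
  · simp [planarPoint]; linarith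
  · simp [planarPoint]; linarith
  · simp [planarPoint, e4]; linarith

/-- Motions in the manifold avoid the branch `r₁ = -k s₁`. Since `r₃ = 0` along the motion,
`ṙ₃ = s₂ (r₁ - k s₁)` vanishes identically. Where `s₂ = 0`, the derivative
`-α s₁ r₁ (r₁ - k s₁)` of this product gives `r₁ = k s₁`, as `s₁` and `r₁` do not vanish there. -/
theorem r₁_eq_of_isMotionIn_imsm {α l₀ : ℝ} (hα : α ≠ 0) (h₀ : l₀ ≠ 0) (l₁ : ℝ) {l₃ : ℝ}
    (h : 0 < l₀ / l₃) {T : ℝ} {x : ℝ → Phase}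
    (hx : IsMotionIn (field α) (imsm α l₀ l₁ l₃) (Ico 0 T) x) {t : ℝ} (ht : t ∈ Ico 0 T) :
    x t 3 = slope α l₀ l₁ * x t 0 := by
  set k := slope α l₀ l₁ with hkdef
  have hR : 0 < √(l₀ / l₃) := Real.sqrt_pos.2 h
  have hk : k ≠ 0 := slope_ne_zero hα h₀ l₁
  have hM := fun u (hu : u ∈ Ico 0 T) => (mem_imsm_iff hα h₀ l₁ h (x u)).1 (hx.2 u hu)
  have hder : ∀ u ∈ Ico 0 T, ∀ i, HasDerivWithinAt (fun u => x u i) (field α (x u) i)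
      (Ico 0 T) u := fun u hu => hasDerivWithinAt_pi.1 (hx.1 u hu)
  have hzero : ∀ {g : ℝ → ℝ} {g' u : ℝ}, u ∈ Ico 0 T → (∀ v ∈ Ico 0 T, g v = 0) →
      HasDerivWithinAt g g' (Ico 0 T) u → g' = 0 := by
    intro g g' u hu hg hg'
    have h0 : HasDerivWithinAt g 0 (Ico 0 T) u :=
      (hasDerivWithinAt_const u _ (0 : ℝ)).congr (fun v hv => hg v hv) (hg u hu)
    exact (uniqueDiffOn_Ico 0 T u hu).eq_deriv _ hg' h0
  have hprod : ∀ u ∈ Ico 0 T, x u 1 * (x u 3 - k * x u 0) = 0 := by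
    intro u hu
    have h1 := hzero hu (fun v hv => (hM v hv).2.2.2.1) (hder u hu 5)
    simp only [field, Matrix.cons_val] at h1
    rw [(hM u hu).2.2.2.2] at h1
    linear_combination h1
  rcases mul_eq_zero.1 (hprod t ht) with hs2 | hr
  · obtain ⟨e1, e2, e3, e4, e5⟩ := hM t ht
    have h1 := hzero ht hprod
      ((hder t ht 1).mul ((hder t ht 3).sub ((hder t ht 0).const_mul k)))
    simp only [field, Matrix.cons_val, hs2, e3, e4] at h1
    have hs1 : x t 0 ≠ 0 := by
      intro hc
      rw [hc, hs2] at e2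
      nlinarith
    have hr1 : x t 3 ≠ 0 := by
      intro hc
      rw [hc, zero_pow two_ne_zero, eq_comm, sq_eq_zero_iff] at e1
      exact mul_ne_zero hk hs1 e1
    have h2 : (α * x t 0 * x t 3) * (x t 3 - k * x t 0) = 0 := by linear_combination -h1
    exact sub_eq_zero.1 ((mul_eq_zero.1 h2).resolve_left (by positivity))
  · exact sub_eq_zero.1 hr

theorem isIntegralCurveOn_of_isMotionIn_imsm {α l₀ : ℝ} (hα : α ≠ 0) (h₀ : l₀ ≠ 0) (l₁ : ℝ)
    {l₃ : ℝ} (h : 0 < l₀ / l₃) {T : ℝ} {x : ℝ → Phase}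
    (hx : IsMotionIn (field α) (imsm α l₀ l₁ l₃) (Ico 0 T) x) :
    IsIntegralCurveOn (fun t => x t 1)
      (fun _ s => -(α * slope α l₀ l₁) * (√(l₀ / l₃) ^ 2 - s ^ 2)) (Ico 0 T) := by
  intro t ht
  refine (hasDerivWithinAt_pi.1 (hx.1 t ht) 1).congr_deriv ?_
  obtain ⟨-, e2, e3, e4, -⟩ := (mem_imsm_iff hα h₀ l₁ h (x t)).1 (hx.2 t ht)
  have hr := r₁_eq_of_isMotionIn_imsm hα h₀ l₁ h hx ht
  simp only [field, Matrix.cons_val, e3, e4, hr]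
  linear_combination -(α * slope α l₀ l₁) * e2

theorem asympStableOn_imsm {α l₀ : ℝ} (hα : 0 < α) (h₀ : 0 < l₀) (l₁ : ℝ) {l₃ : ℝ}
    (h₃ : 0 < l₃) :
    AsympStableOn (field α) (imsm α l₀ l₁ l₃) (planarPoint (slope α l₀ l₁) 0 (-√(l₀ / l₃))) := by
  have h : 0 < l₀ / l₃ := by positivity
  have hc : 0 < α * slope α l₀ l₁ := mul_pos hα (slope_pos hα.ne' h₀ l₁)
  have hR : 0 < √(l₀ / l₃) := Real.sqrt_pos.2 h
  have hnorm := fun {x : Phase} => norm_sub_planarPoint_le (x := x) hα.ne' h₀.ne' l₁ h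
  have hred := fun {T : ℝ} {x : ℝ → Phase} =>
    isIntegralCurveOn_of_isMotionIn_imsm (T := T) (x := x) hα.ne' h₀.ne' l₁ h
  have hcoord : ∀ x : Phase, |x 1 + √(l₀ / l₃)|
      ≤ ‖x - planarPoint (slope α l₀ l₁) 0 (-√(l₀ / l₃))‖ := fun x => by
    simpa [planarPoint] using
      norm_le_pi_norm (x - planarPoint (slope α l₀ l₁) 0 (-√(l₀ / l₃))) 1
  set p := planarPoint (slope α l₀ l₁) 0 (-√(l₀ / l₃))
  set k := slope α l₀ l₁
  set R := √(l₀ / l₃)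
  have hlim : Tendsto (fun z : ℝ => (1 + |k|) * (|z| + √(2 * R * |z|))) (𝓝 0) (𝓝 0) := by
    have : Continuous fun z : ℝ => (1 + |k|) * (|z| + √(2 * R * |z|)) := by fun_prop
    simpa using this.tendsto 0
  constructor
  · intro ε hε
    obtain ⟨η, hη, hball⟩ := Metric.eventually_nhds_iff.1 (hlim.eventually_lt_const hε)
    refine ⟨min R (η / 2), by positivity, fun T _ x hx h0 t ht => ?_⟩
    obtain ⟨h1, h2⟩ := lt_min_iff.1 ((hcoord (x 0)).trans_lt h0)
    have h3 := abs_add_le_of_integralCurveOn hc hR (hred hx) h1.le ht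
    have h4 : 2 * |x 0 1 + R| / Real.exp (α * k * R * t) ^ 2 ≤ 2 * |x 0 1 + R| :=
      div_le_self (by positivity) (one_le_exp_sq hc hR ht.1)
    refine (hnorm (hx.2 t ht)).trans_lt (hball ?_)
    rw [dist_zero_right, Real.norm_eq_abs]
    linarith
  · refine ⟨R, hR, fun x hx h0 => ?_⟩
    have h1 : |x 0 1 + R| ≤ R := ((hcoord (x 0)).trans_lt h0).le
    have hs2 : Tendsto (fun t => x t 1 + R) atTop (𝓝 0) := by
      rw [tendsto_zero_iff_abs_tendsto_zero]
      refine squeeze_zero' (Eventually.of_forall fun _ => abs_nonneg _) ?_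
        (tendsto_const_div_exp_sq hc hR (2 * |x 0 1 + R|))
      filter_upwards [eventually_ge_atTop 0] with t ht
      exact abs_add_le_of_integralCurveOn (T := t + 1) hc hR
        (hred ⟨hx.1.mono Ico_subset_Ici_self, fun u hu => hx.2 u hu.1⟩) h1 ⟨ht, by linarith⟩
    rw [tendsto_iff_norm_sub_tendsto_zero]
    refine squeeze_zero' (Eventually.of_forall fun _ => norm_nonneg _) ?_ (hlim.comp hs2)
    filter_upwards [eventually_ge_atTop 0] with t ht using hnorm (hx.2 t ht)

end SokolovTop

theorem mainTheorem7 (α l₀ l₁ l₃ : ℝ) :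
    -- for positive `λ₀, λ₃` the reduced equation is the flow on the manifold, `s₂⁰` is an
    -- equilibrium of it, and the full-space solution is the only point of the manifold over `s₂⁰`
    (α ≠ 0 → 0 < l₀ → 0 < l₃ →
      (∀ T > 0, ∀ x : ℝ → SokolovTop.Phase,
        SokolovTop.IsMotionIn (SokolovTop.field α) (SokolovTop.imsm α l₀ l₁ l₃) (Ico 0 T) x →
        IsIntegralCurveOn (fun t => x t 1)
          (fun _ => SokolovTop.reducedField α l₀ l₁ l₃) (Ico 0 T)) ∧
      (∀ s₁ s₂ : ℝ, s₁ ^ 2 + s₂ ^ 2 = l₀ / l₃ → ∃ x : ℝ → SokolovTop.Phase,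
        SokolovTop.IsMotionIn (SokolovTop.field α) (SokolovTop.imsm α l₀ l₁ l₃) (Ici 0) x ∧
        x 0 0 = s₁ ∧ x 0 1 = s₂) ∧
      SokolovTop.reducedField α l₀ l₁ l₃ (SokolovTop.s₂eq l₀ l₃) = 0 ∧
      {p ∈ SokolovTop.imsm α l₀ l₁ l₃ | p 1 = SokolovTop.s₂eq l₀ l₃}
        = {SokolovTop.fullPoint α l₀ l₁ l₃}) ∧
    -- asymptotic stability on the manifold
    (SokolovTop.CondAsymp α l₀ l₁ l₃ →
      SokolovTop.IsStrictLyapunov (SokolovTop.reducedField α l₀ l₁ l₃)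
        (SokolovTop.s₂eq l₀ l₃) (fun z => z ^ 2 / 2) ∧
      (∃ ρ > 0, ∀ σ : ℝ, |σ - SokolovTop.s₂eq l₀ l₃| < ρ → ∃ s : ℝ → ℝ,
        IsIntegralCurveOn s (fun _ => SokolovTop.reducedField α l₀ l₁ l₃) (Ici 0) ∧ s 0 = σ) ∧
      SokolovTop.AsympStableOn (SokolovTop.reducedField α l₀ l₁ l₃) univ
        (SokolovTop.s₂eq l₀ l₃) ∧
      SokolovTop.AsympStableOn (SokolovTop.field α) (SokolovTop.imsm α l₀ l₁ l₃)
        (SokolovTop.fullPoint α l₀ l₁ l₃)) ∧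
    -- instability on the manifold
    (SokolovTop.CondUnst α l₀ l₁ l₃ →
      SokolovTop.UnstableOn (SokolovTop.reducedField α l₀ l₁ l₃) univ
        (SokolovTop.s₂eq l₀ l₃) ∧
      SokolovTop.UnstableOn (SokolovTop.field α) (SokolovTop.imsm α l₀ l₁ l₃)
        (SokolovTop.fullPoint α l₀ l₁ l₃)) ∧
    -- instability in the whole phase space; for negative `λ₀, λ₃` both readings of the sign of the
    -- root in the coordinate `r₂` are covered
    (SokolovTop.CondFull α l₀ l₁ l₃ →
      (∃! p : SokolovTop.Phase,
        p ∈ SokolovTop.imsm α l₀ l₁ l₃ ∧ p 1 = SokolovTop.s₂eq l₀ l₃) ∧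
      ∀ p : SokolovTop.Phase,
        (p = SokolovTop.fullPoint α l₀ l₁ l₃ ∨
          (p ∈ SokolovTop.imsm α l₀ l₁ l₃ ∧ p 1 = SokolovTop.s₂eq l₀ l₃)) →
        SokolovTop.field α p = 0 ∧
        SokolovTop.HasUnstableEigenvalue (SokolovTop.field α) p ∧
        SokolovTop.UnstableOn (SokolovTop.field α) univ p) := by
  refine ⟨fun hα h₀ h₃ => ?_, fun ⟨hα, h₀, h13⟩ => ?_, fun ⟨hα, h₀, h13⟩ => ?_, fun hc => ?_⟩
  · have h : 0 < l₀ / l₃ := by positivity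
    have hR : 0 < √(l₀ / l₃) := Real.sqrt_pos.2 h
    refine ⟨fun T _ x hx => ?_, fun s₁ s₂ hs => ?_, ?_, ?_⟩
    · rw [SokolovTop.reducedField_eq hα h₀ h₃]
      exact SokolovTop.isIntegralCurveOn_of_isMotionIn_imsm hα h₀.ne' l₁ h hx
    · rw [← Real.sq_sqrt h.le] at hs
      refine ⟨_, SokolovTop.exists_planarMotion (α := α) hR hs
        (SokolovTop.planarPoint_mem_imsm hα h₀.ne' l₁ h) _, ?_, ?_⟩
      · exact SokolovTop.bump_zero hR _ _ _
      · exact SokolovTop.kink_zero hR _ _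
    · rw [SokolovTop.reducedField_eq hα h₀ h₃, SokolovTop.s₂eq]
      ring
    · ext x
      rw [SokolovTop.fullPoint_eq_of_pos hα h₀ l₁ h₃]
      exact SokolovTop.mem_imsm_and_eq_s₂eq_iff hα h₀.ne' l₁ h x
  · have h₃ : 0 < l₃ := h13.elim And.right And.right
    have hR : 0 < √(l₀ / l₃) := Real.sqrt_pos.2 (by positivity)
    have hk : 0 < α * SokolovTop.slope α l₀ l₁ := mul_pos hα (SokolovTop.slope_pos hα.ne' h₀ l₁)
    rw [SokolovTop.reducedField_eq hα.ne' h₀ h₃, SokolovTop.fullPoint_eq_of_pos hα.ne' h₀ l₁ h₃,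
      SokolovTop.s₂eq]
    refine ⟨SokolovTop.isStrictLyapunov_scalar hk hR, ⟨√(l₀ / l₃), hR, fun σ hσ => ?_⟩,
      SokolovTop.asympStableOn_scalar hk hR, SokolovTop.asympStableOn_imsm hα h₀ l₁ h₃⟩
    rw [sub_neg_eq_add] at hσ
    exact ⟨_, fun t ht => (SokolovTop.hasDerivAt_kink (SokolovTop.kinkDenom_pos_of_nonneg hk hR
      (by linarith [(abs_lt.1 hσ).2]) ht).ne').hasDerivWithinAt, SokolovTop.kink_zero hR _ _⟩
  · have h₃ : 0 < l₃ := h13.elim And.right And.right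
    have h : 0 < l₀ / l₃ := by positivity
    have hR : 0 < √(l₀ / l₃) := Real.sqrt_pos.2 h
    have hk : α * SokolovTop.slope α l₀ l₁ < 0 :=
      mul_neg_of_neg_of_pos hα (SokolovTop.slope_pos hα.ne h₀ l₁)
    rw [SokolovTop.reducedField_eq hα.ne h₀ h₃, SokolovTop.fullPoint_eq_of_pos hα.ne h₀ l₁ h₃,
      SokolovTop.s₂eq]
    exact ⟨SokolovTop.unstableOn_scalar hk hR, SokolovTop.unstableOn_planarPoint hR hk
      (SokolovTop.planarPoint_mem_imsm hα.ne h₀.ne' l₁ h)⟩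
  · obtain ⟨hα, h₀, h⟩ : α ≠ 0 ∧ l₀ ≠ 0 ∧ 0 < l₀ / l₃ := by
      rcases hc with ⟨hα, ⟨h₀, -, h₃⟩ | ⟨h₀, -, h₃⟩⟩ | ⟨hα, ⟨h₀, -, h₃⟩ | ⟨h₀, -, h₃⟩⟩
      · exact ⟨hα.ne, h₀.ne, div_pos_of_neg_of_neg h₀ h₃⟩
      · exact ⟨hα.ne, h₀.ne', div_pos h₀ h₃⟩
      · exact ⟨hα.ne', h₀.ne, div_pos_of_neg_of_neg h₀ h₃⟩
      · exact ⟨hα.ne', h₀.ne', div_pos h₀ h₃⟩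
    have hR : 0 < √(l₀ / l₃) := Real.sqrt_pos.2 h
    have hp : ∀ k : ℝ, k ≠ 0 →
        SokolovTop.field α (SokolovTop.planarPoint k 0 (-√(l₀ / l₃))) = 0 ∧
        SokolovTop.HasUnstableEigenvalue (SokolovTop.field α)
          (SokolovTop.planarPoint k 0 (-√(l₀ / l₃))) ∧
        SokolovTop.UnstableOn (SokolovTop.field α) univ
          (SokolovTop.planarPoint k 0 (-√(l₀ / l₃))) := fun k hk =>
      ⟨SokolovTop.field_planarPoint_zero α k _,
        SokolovTop.hasUnstableEigenvalue_planarPoint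
          (mul_ne_zero (mul_ne_zero hα hk) (neg_ne_zero.2 hR.ne')),
        SokolovTop.unstableOn_univ_planarPoint hR (mul_ne_zero hα hk)⟩
    simp only [SokolovTop.mem_imsm_and_eq_s₂eq_iff hα h₀ l₁ h]
    refine ⟨⟨_, rfl, fun _ hy => hy⟩, ?_⟩
    rintro p (rfl | rfl)
    · rw [SokolovTop.fullPoint_eq hα l₁ h]
      have := (le_abs_self l₁).trans_lt (SokolovTop.abs_lt_radical hα h₀ l₁)
      exact hp _ (div_ne_zero (by linarith) (by positivity))
    · exact hp _ (SokolovTop.slope_ne_zero hα h₀ l₁)
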